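/- Let $(M,\omega)$ be a compact Kähler manifold of complex dimension $n$, and let $E\to M$ be a holomorphic vector bundle of rank $r$ which is globally generated, i.e. every vector of every fibre is the value of a global holomorphic section (for instance, $E$ very ample). Put $N=\dim H^0(M,E)$. For a basis $\underline s=(s_1,\dots,s_N)$ of $H^0(M,E)$ let $i_{\underline s}:M\to G(r,N)$ be its Kodaira map: in a local frame $\sigma_1,\dots,\sigma_r$ of $E$ with $s_j=\sum_\alpha S_{j\alpha}\sigma_\alpha$, the point $i_{\underline s}(x)$ is the column space in $\mathbb C^N$ of the $N\times r$ matrix $(S_{j\alpha}(x))$. Let $\mathcal T\to G(r,N)$ be the tautological bundle with the flat metric $h_0(v,w)=w^*v$, let $h_{Gr}$ be the dual metric on $\mathcal Q=\mathcal T^*$, and let $h_{\underline s}=i_{\underline s}^*h_{Gr}$ be the Hermitian metric on $E$ obtained from the canonical isomorphism $E\cong i_{\underline s}^*\mathcal Q$ which sends $v\in E_x$ to the functional $(\lambda(s_1(x)),\dots,\lambda(s_N(x)))\mapsto\lambda(v)$, $\lambda\in E_x^*$. The basis $\underline s$ is called $\omega$-balanced if $$\frac1{V(M)}\int_M h_{\underline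 s}(s_j,s_k)\,\frac{\omega^n}{n!}=\frac rN\,\delta_{jk}\quad(1\le j,k\le N),\qquad V(M)=\int_M\frac{\omega^n}{n!},$$ and a Hermitian metric on $E$ is called $\omega$-balanced if it equals $h_{\underline s}$ for some $\omega$-balanced basis $\underline s$. Let $\operatorname{Aut}(E)$ be the group of holomorphic automorphisms of $E$ covering the identity of $M$. If $E$ admits an $\omega$-balanced metric, then this metric is unique up to $\operatorname{Aut}(E)$. Precisely: (1) If $h$ is an $\omega$-balanced metric on $E$, then a Hermitian metric $h'$ on $E$ is $\omega$-balanced if and only if there is $F\in\operatorname{Aut}(E)$ with $h'(Fv,Fw)=h(v,w)$ for all $x\in M$ and $v,w\in E_x$. (2) If $\underline s$ and $\underline s'$ are $\omega$-balanced bases of $H^0(M,E)$, then there are a unitary matrix $U\in U(N)$ and $F\in\operatorname{Aut}(E)$ such that $s'_j=\sum_k U_{jk}\,F s_k$ for all $j$, $i_{\underline s'}=U\,i_{\underline s}$, and $h_{\underline s'}(Fv,Fw)=h_{\underline s}(v,w)$ for all $x\in M$ and $v,w\in E_x$. No simplicity of $E$ is assumed. -/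

import Mathlib

open Bundle Module
open scoped Manifold ContDiff

noncomputable section

/-- Complex affine space `ℂⁿ`: model of an `n`-dimensional complex manifold, and model fibre of a
holomorphic vector bundle. -/
abbrev Cx (n : ℕ) : Type := Fin n → ℂ

/-! ### Kähler forms and integration against `ω ^ n / n!` -/

section Kaehler

variable {n : ℕ} {M : Type*} [TopologicalSpace M] [ChartedSpace (Cx n) M]

/-- The pullback to chart coordinates of a field of real bilinear forms on the tangent spaces, by
the inverse of the chart at `p`; here `y` is a point of the chart's target. -/
def chartForm
    (β : (x : M) → TangentSpace 𝓘(ℂ, Cx n) x →ₗ[ℝ] TangentSpace 𝓘(ℂ, Cx n) x →ₗ[ℝ] ℝ)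
    (p : M) (y : Cx n) (v w : Cx n) : ℝ :=
  β ((chartAt (Cx n) p).symm y)
    (mfderiv 𝓘(ℂ, Cx n) 𝓘(ℂ, Cx n) (chartAt (Cx n) p).symm y v)
    (mfderiv 𝓘(ℂ, Cx n) 𝓘(ℂ, Cx n) (chartAt (Cx n) p).symm y w)

variable (n M) in
/-- A Kähler form on a complex manifold `M` of dimension `n`: a smooth closed real `2`-form that is
invariant under the complex structure and positive. -/
structure KaehlerForm where
  /-- the value of the form on two tangent vectors at a point -/
  form : (x : M) → TangentSpace 𝓘(ℂ, Cx n) x →ₗ[ℝ] TangentSpace 𝓘(ℂ, Cx n) x →ₗ[ℝ] ℝ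
  alternating : ∀ (x : M) (v : TangentSpace 𝓘(ℂ, Cx n) x), form x v v = 0
  complex_invariant : ∀ (x : M) (v w : TangentSpace 𝓘(ℂ, Cx n) x),
    form x (Complex.I • v) (Complex.I • w) = form x v w
  positive : ∀ (x : M) (v : TangentSpace 𝓘(ℂ, Cx n) x), v ≠ 0 → 0 < form x v (Complex.I • v)
  smooth : ∀ (p : M) (v w : Cx n),
    ContDiffOn ℝ ∞ (fun y => chartForm form p y v w) (chartAt (Cx n) p).target
  /-- `dω (u, v, w) = 0` in each chart, for the constant vector fields `u`, `v`, `w` -/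
  closed : ∀ (p : M), ∀ y ∈ (chartAt (Cx n) p).target, ∀ u v w : Cx n,
    fderiv ℝ (fun z => chartForm form p z v w) y u
      + fderiv ℝ (fun z => chartForm form p z w u) y v
      + fderiv ℝ (fun z => chartForm form p z u v) y w = 0

/-- The value of the `2n`-form `β ^ n / n!` (`n`-fold wedge power of a `2`-form `β`) on the vectors
`v (0, 0), v (0, 1), v (1, 0), v (1, 1), …`. -/
def wedgePowDivFactorial (n : ℕ) {V : Type*} (β : V → V → ℝ) (v : Fin n × Fin 2 → V) : ℝ :=
  (1 / (2 ^ n * (n.factorial : ℝ))) *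
    ∑ σ : Equiv.Perm (Fin n × Fin 2),
      ((Equiv.Perm.sign σ : ℤ) : ℝ) * ∏ i : Fin n, β (v (σ (i, 0))) (v (σ (i, 1)))

/-- The positively oriented real frame `∂/∂x₁, ∂/∂y₁, …, ∂/∂xₙ, ∂/∂yₙ` of `ℂⁿ`. -/
def realFrame (n : ℕ) (a : Fin n × Fin 2) : Cx n :=
  Pi.single a.1 (if a.2 = 0 then 1 else Complex.I)

/-- The function `D` such that `ω ^ n / n! = D dx₁ ∧ dy₁ ∧ … ∧ dxₙ ∧ dyₙ` in the chart at `p`. -/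
def KaehlerForm.density (κ : KaehlerForm n M) (p : M) (y : Cx n) : ℝ :=
  wedgePowDivFactorial n (chartForm κ.form p y) (realFrame n)

variable (n M) in
theorem exists_chartPartition [CompactSpace M] [T2Space M] :
    ∃ ρ : PartitionOfUnity M M Set.univ,
      ρ.IsSubordinate fun p => (chartAt (Cx n) p).source :=
  PartitionOfUnity.exists_isSubordinate isClosed_univ _
    (fun p => (chartAt (Cx n) p).open_source)
    (fun p _ => Set.mem_iUnion.2 ⟨p, mem_chart_source (Cx n) p⟩)

variable (n M) in
/-- A partition of unity subordinate to the covering of `M` by its preferred charts. -/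
def chartPartition [CompactSpace M] [T2Space M] : PartitionOfUnity M M Set.univ :=
  (exists_chartPartition n M).choose

variable [CompactSpace M] [T2Space M]

/-- The integral `∫_M f ω ^ n / n!` of a continuous function, computed in charts with a partition
of unity. By compactness only finitely many terms of the sum are nonzero. -/
def KaehlerForm.integral (κ : KaehlerForm n M) (f : M → ℂ) : ℂ :=
  ∑ᶠ p : M, ∫ y in (chartAt (Cx n) p).target,
    ((chartPartition n M p ((chartAt (Cx n) p).symm y) * κ.density p y : ℝ) : ℂ)
      * f ((chartAt (Cx n) p).symm y)

/-- The volume `V(M) = ∫_M ω ^ n / n!`. -/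
def KaehlerForm.vol (κ : KaehlerForm n M) : ℂ := κ.integral fun _ => 1

end Kaehler

/-! ### The Grassmannian and its tautological and quotient bundles -/

/-- The Grassmannian `G(r, N)` of `r`-dimensional subspaces of `ℂᴺ`. -/
def Gr (r N : ℕ) : Type :=
  {T : Submodule ℂ (EuclideanSpace ℂ (Fin N)) // finrank ℂ T = r}

/-- The fibre of the tautological bundle `𝒯` over a point of `G(r, N)`: the subspace itself. It
carries the flat metric `h₀(v, w) = w⋆ v` induced by `ℂᴺ`, that is `h₀(v, w) = inner ℂ w v`. -/
abbrev Gr.Taut {r N : ℕ} (T : Gr r N) : Type := T.1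

/-- The fibre of the bundle `𝒬 = 𝒯⋆` over a point of `G(r, N)`. -/
abbrev Gr.Quot {r N : ℕ} (T : Gr r N) : Type := StrongDual ℂ T.Taut

/-- The metric `h_Gr` on `𝒬 = 𝒯⋆` dual to `h₀`: if `φ = h₀(·, a)` and `ψ = h₀(·, b)` then
`h_Gr(φ, ψ) = h₀(b, a)`. It is linear in `φ` and conjugate linear in `ψ`. -/
def Gr.metric {r N : ℕ} (T : Gr r N) (φ ψ : T.Quot) : ℂ :=
  inner ℂ ((InnerProductSpace.toDual ℂ T.Taut).symm φ) ((InnerProductSpace.toDual ℂ T.Taut).symm ψ)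

/-! ### Holomorphic vector bundles -/

section HolomorphicBundle

variable {n r : ℕ} {M : Type*} [TopologicalSpace M] [ChartedSpace (Cx n) M]
  (E : M → Type*) [∀ x, AddCommGroup (E x)] [∀ x, Module ℂ (E x)]
  [∀ x, TopologicalSpace (E x)] [TopologicalSpace (TotalSpace (Cx r) E)]
  [FiberBundle (Cx r) E] [VectorBundle ℂ (Cx r) E]

variable (n r) in
/-- The space `H⁰(M, E)` of global holomorphic sections. (Over `ℂ` the smoothness exponent `ω`
means complex analytic.) -/
abbrev H0 : Type _ := ContMDiffSection 𝓘(ℂ, Cx n) (Cx r) ω E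

variable (n r) in
/-- `E` is globally generated: every vector of every fibre is the value of a global holomorphic
section. -/
def GloballyGenerated : Prop :=
  ∀ (x : M) (v : E x), ∃ s : H0 n r E, s x = v

variable (n r) in
/-- An automorphism of the holomorphic vector bundle `E`: a fibrewise linear biholomorphism of the
total space which covers the identity of `M`. -/
structure BundleAut where
  toEquiv : (x : M) → E x ≃ₗ[ℂ] E x
  holomorphic : ContMDiff (𝓘(ℂ, Cx n).prod 𝓘(ℂ, Cx r)) (𝓘(ℂ, Cx n).prod 𝓘(ℂ, Cx r)) ω
    (fun z : TotalSpace (Cx r) E => (⟨z.1, toEquiv z.1 z.2⟩ : TotalSpace (Cx r) E))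
  holomorphic_symm : ContMDiff (𝓘(ℂ, Cx n).prod 𝓘(ℂ, Cx r)) (𝓘(ℂ, Cx n).prod 𝓘(ℂ, Cx r)) ω
    (fun z : TotalSpace (Cx r) E => (⟨z.1, (toEquiv z.1).symm z.2⟩ : TotalSpace (Cx r) E))

variable (n r) in
/-- A smooth Hermitian metric on `E`, linear in the first variable. Smoothness is smoothness of the
matrix coefficients in the local trivializations of `E`, as functions on the real manifold
underlying `M`. -/
structure HermitianMetric where
  toFun : (x : M) → E x → E x → ℂ
  add_left : ∀ x u v w, toFun x (u + v) w = toFun x u w + toFun x v w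
  smul_left : ∀ x (c : ℂ) v w, toFun x (c • v) w = c * toFun x v w
  conj_symm : ∀ x v w, (starRingEnd ℂ) (toFun x v w) = toFun x w v
  pos : ∀ x v, v ≠ 0 → 0 < (toFun x v v).re
  smooth : ∀ (p : M) (a b : Cx r), ContMDiffOn 𝓘(ℝ, Cx n) 𝓘(ℝ, ℂ) ∞
    (fun x => toFun x ((trivializationAt (Cx r) E p).symm x a)
      ((trivializationAt (Cx r) E p).symm x b))
    (trivializationAt (Cx r) E p).baseSet

variable (r) in
/-- A linear isomorphism of a fibre of `E` with `ℂʳ`. -/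
def fibreEquiv (x : M) : E x ≃ₗ[ℂ] Cx r :=
  (trivializationAt (Cx r) E x).linearEquivAt ℂ x (mem_baseSet_trivializationAt (Cx r) E x)

/-! ### The Kodaira map of a basis of `H⁰(M, E)` and the induced metric -/

variable {E}

/-- The map `E_x⋆ → ℂᴺ`, `λ ↦ (λ (s₁ x), …, λ (s_N x))`. In terms of a frame `σ₁, …, σᵣ` of `E`
near `x` with `s_j = ∑ S_{jα} σ_α`, it sends `λ` to `S(x) (λ (σ₁ x), …, λ (σᵣ x))ᵗ`. -/
def evalDual {N : ℕ} (s : Basis (Fin N) ℂ (H0 n r E)) (x : M) :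
    Dual ℂ (E x) →ₗ[ℂ] EuclideanSpace ℂ (Fin N) where
  toFun l := WithLp.toLp 2 fun j => l (s j x)
  map_add' l m := by ext j; simp
  map_smul' c l := by ext j; simp

theorem evalDual_injective {N : ℕ} (hE : GloballyGenerated n r E)
    (s : Basis (Fin N) ℂ (H0 n r E)) (x : M) : Function.Injective (evalDual s x) := by
  rw [injective_iff_map_eq_zero]
  intro l hl
  ext v
  obtain ⟨t, rfl⟩ := hE x v
  let ev : H0 n r E →ₗ[ℂ] ℂ :=
    { toFun := fun u => l (u x)
      map_add' := fun u w => by simp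
      map_smul' := fun c u => by simp }
  have h0 : ev = 0 := s.ext fun j => by
    have := congrArg (fun z : EuclideanSpace ℂ (Fin N) => z j) hl
    simpa [evalDual, ev] using this
  exact LinearMap.congr_fun h0 t

/-- The Kodaira map `i_s : M → G(r, N)` of a basis `s` of `H⁰(M, E)`. In a local frame of `E` the
point `i_s x` is the column space of the matrix `S(x)` of the coefficients of `s₁, …, s_N`. -/
def kodairaMap {N : ℕ} (hE : GloballyGenerated n r E) (s : Basis (Fin N) ℂ (H0 n r E)) (x : M) :
    Gr r N :=
  ⟨LinearMap.range (evalDual s x), by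
    rw [LinearMap.finrank_range_of_inj (evalDual_injective hE s x), Subspace.dual_finrank_eq,
      (fibreEquiv r E x).finrank_eq, Module.finrank_fin_fun]⟩

/-- The identification of `E_x⋆` with the fibre of `𝒯` at `i_s x`. -/
def dualEquivTaut {N : ℕ} (hE : GloballyGenerated n r E) (s : Basis (Fin N) ℂ (H0 n r E)) (x : M) :
    Dual ℂ (E x) ≃ₗ[ℂ] (kodairaMap hE s x).Taut :=
  LinearEquiv.ofInjective (evalDual s x) (evalDual_injective hE s x)

/-- The canonical isomorphism `E ≅ i_s⋆ 𝒬`: a vector `v ∈ E_x` is sent to the functional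
`(λ (s₁ x), …, λ (s_N x)) ↦ λ v` on the fibre of `𝒯` at `i_s x`. -/
def toQuot {N : ℕ} (hE : GloballyGenerated n r E) (s : Basis (Fin N) ℂ (H0 n r E)) (x : M)
    (v : E x) : (kodairaMap hE s x).Quot :=
  LinearMap.toContinuousLinearMap
    ((Dual.eval ℂ (E x) v).comp (dualEquivTaut hE s x).symm.toLinearMap)

/-- The metric `h_s = i_s⋆ h_Gr` on `E = i_s⋆ 𝒬`. -/
def inducedMetric {N : ℕ} (hE : GloballyGenerated n r E) (s : Basis (Fin N) ℂ (H0 n r E)) (x : M)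
    (v w : E x) : ℂ :=
  (kodairaMap hE s x).metric (toQuot hE s x v) (toQuot hE s x w)

variable [CompactSpace M] [T2Space M]

/-- The `L²` product `(1 / V(M)) ∫_M h(t, u) ω ^ n / n!` on `H⁰(M, E)`. -/
def l2Product (κ : KaehlerForm n M) (h : (x : M) → E x → E x → ℂ) (t u : H0 n r E) : ℂ :=
  (κ.vol)⁻¹ * κ.integral fun x => h x (t x) (u x)

/-- The basis `s` of `H⁰(M, E)` is `ω`-balanced: `⟨s_j, s_k⟩ = (r / N) δ_{jk}` for the `L²` product
of `h_s`. -/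
def IsBalancedBasis {N : ℕ} (κ : KaehlerForm n M) (hE : GloballyGenerated n r E)
    (s : Basis (Fin N) ℂ (H0 n r E)) : Prop :=
  ∀ j k : Fin N, l2Product κ (inducedMetric hE s) (s j) (s k) =
    if j = k then (r : ℂ) / (N : ℂ) else 0

/-- The Hermitian metric `h` is `ω`-balanced: `h = h_s` for an `ω`-balanced basis `s`. -/
def IsBalancedMetric (κ : KaehlerForm n M) (hE : GloballyGenerated n r E)
    (h : HermitianMetric n r E) : Prop :=
  ∃ (N : ℕ) (s : Basis (Fin N) ℂ (H0 n r E)),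
    (∀ (x : M) (v w : E x), h.toFun x v w = inducedMetric hE s x v w) ∧ IsBalancedBasis κ hE s

end HolomorphicBundle

end

/-! In a local frame let `S(x)` be the `N × r` coefficient matrix of a basis `s`, and let `P(x)` be
the orthogonal projection of `ℂᴺ` onto its column space. Then `h_s(s_j, s_k) = P_jk`
(`inducedMetric_basis`), so `s` is balanced exactly when the mean of `P` over `M` is `(r / N) · 1`.

Let `s' = A s` be a second balanced basis, with projection `Q` onto the column space of `A S`. Since
`Q A P = A P`, one finds `tr(Q A A⋆) - tr(P A⋆ A) = ‖Q A - A P‖²` pointwise, in the Hilbert–Schmidt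
norm (`trace_columnProj_sub`). Balance turns the integral of the left side into a multiple of `tr(A
A⋆) - tr(A⋆ A) = 0`. The volume density is positive and the right side continuous, so `Q A = A P`
everywhere (`IsBalancedBasis.columnProj_intertwine`).

Hence every `P(x)` commutes with `A⋆ A`, and with its square root `G` in the polar decomposition `A
= U G`. A matrix commuting with all `P(x)` preserves all the column spaces and so comes from an
automorphism `F` of `E` (`exists_bundleAut_of_commute`). Thus `s' = U F s`; the unitary factor does
not affect the induced metric, and `F` is the required isometry. Irreducibility is never used, so
`E` need not be simple. -/

noncomputable section

/-! ### Orthogonal projections onto column spaces, and the polar decomposition -/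

section Matrices

open Matrix
open scoped MatrixOrder ComplexOrder

variable {m k : Type*} [Fintype m] [Fintype k] [DecidableEq k]

/-- The orthogonal projection onto the column space of a matrix with independent columns. -/
def columnProj (S : Matrix m k ℂ) : Matrix m m ℂ := S * (Sᴴ * S)⁻¹ * Sᴴ

theorem columnProj_isHermitian (S : Matrix m k ℂ) : (columnProj S)ᴴ = columnProj S := by
  simp [columnProj, conjTranspose_nonsing_inv, Matrix.mul_assoc]

theorem columnProj_mul {S : Matrix m k ℂ} (hS : IsUnit (Sᴴ * S).det) : columnProj S * S = S := by
  rw [columnProj, Matrix.mul_assoc, Matrix.mul_assoc, nonsing_inv_mul _ hS, Matrix.mul_one]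

theorem mul_mul_columnProj {S : Matrix m k ℂ} {A B : Matrix m m ℂ} (h : B * (A * S) = A * S) :
    B * A * columnProj S = A * columnProj S := by
  simp only [columnProj, ← Matrix.mul_assoc] at h ⊢
  rw [h]

theorem columnProj_mul_self {S : Matrix m k ℂ} (hS : IsUnit (Sᴴ * S).det) :
    columnProj S * columnProj S = columnProj S := by
  nth_rw 2 [columnProj]
  rw [← Matrix.mul_assoc, ← Matrix.mul_assoc, columnProj_mul hS, columnProj]

/-- With `P`, `Q` the two projections, `Q A P = A P` because `Q` fixes the columns of `A S`. Both
cross terms in the expansion of the square therefore equal `A P A⋆`, and so does the last term; one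
copy survives with a minus sign. -/
theorem trace_columnProj_sub {S : Matrix m k ℂ} {A : Matrix m m ℂ} (hS : IsUnit (Sᴴ * S).det)
    (hAS : IsUnit ((A * S)ᴴ * (A * S)).det) :
    (columnProj (A * S) * (A * Aᴴ)).trace - (columnProj S * (Aᴴ * A)).trace =
      ((columnProj (A * S) * A - A * columnProj S) *
        (columnProj (A * S) * A - A * columnProj S)ᴴ).trace := by
  have h1 : columnProj (A * S) * A * columnProj S = A * columnProj S :=
    mul_mul_columnProj (columnProj_mul hAS)
  have hQ := columnProj_isHermitian (A * S)
  have hP := columnProj_isHermitian S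
  have hQQ := columnProj_mul_self hAS
  have hPP := columnProj_mul_self hS
  set Q := columnProj (A * S)
  set P := columnProj S
  have h2 : P * Aᴴ * Q = P * Aᴴ := by
    simpa [hQ, hP, Matrix.mul_assoc] using congrArg conjTranspose h1
  have e1 : (Q * A * (Aᴴ * Q)).trace = (Q * (A * Aᴴ)).trace := by
    rw [← Matrix.mul_assoc, trace_mul_comm, ← Matrix.mul_assoc, ← Matrix.mul_assoc, hQQ,
      Matrix.mul_assoc]
  have e2 : (A * P * (P * Aᴴ)).trace = (P * (Aᴴ * A)).trace := by
    rw [← Matrix.mul_assoc, Matrix.mul_assoc A, hPP, Matrix.mul_assoc, trace_mul_comm,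
      Matrix.mul_assoc]
  have e3 : Q * A * (P * Aᴴ) = A * P * (P * Aᴴ) := by
    rw [← Matrix.mul_assoc, h1, ← Matrix.mul_assoc, Matrix.mul_assoc A P P, hPP]
  have e4 : A * P * (Aᴴ * Q) = A * P * (P * Aᴴ) := by
    rw [Matrix.mul_assoc A P, ← Matrix.mul_assoc P, h2, Matrix.mul_assoc A P, ← Matrix.mul_assoc P P,
      hPP]
  rw [conjTranspose_sub, conjTranspose_mul, conjTranspose_mul, hQ, hP, Matrix.sub_mul,
    Matrix.mul_sub, Matrix.mul_sub, e3, e4, sub_self, sub_zero, trace_sub, e1, e2]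

theorem trace_mul_conjTranspose_eq_sum (X : Matrix m m ℂ) :
    (X * Xᴴ).trace = ((∑ i, ∑ j, ‖X i j‖ ^ 2 : ℝ) : ℂ) := by
  simp [trace, mul_apply, Complex.mul_conj, Complex.normSq_eq_norm_sq]

/-- With `Q` the projection for `A S`, the relation and its adjoint `A⋆ Q = P A⋆` give `P A⋆ A = A⋆
Q A = A⋆ A P`. -/
theorem commute_columnProj {S : Matrix m k ℂ} {A : Matrix m m ℂ}
    (h : columnProj (A * S) * A = A * columnProj S) : Commute (columnProj S) (Aᴴ * A) := by
  have h' : Aᴴ * columnProj (A * S) = columnProj S * Aᴴ := by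
    simpa [columnProj_isHermitian] using congrArg conjTranspose h
  change _ * _ = _ * _
  rw [← Matrix.mul_assoc, ← h', Matrix.mul_assoc, h, Matrix.mul_assoc]

-- `G` is the positive square root of `A⋆ A`. The operator norm makes the matrices a C⋆-algebra, and
-- the functional calculus shows that whatever commutes with `A⋆ A` commutes with `G`.
open scoped Matrix.Norms.L2Operator in
theorem exists_polar [DecidableEq m] {A : Matrix m m ℂ} (hA : IsUnit A) :
    ∃ U ∈ Matrix.unitaryGroup m ℂ, ∃ G : Matrix m m ℂ, IsUnit G ∧ A = U * G ∧
      ∀ P : Matrix m m ℂ, Commute P (Aᴴ * A) → Commute P G := by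
  have hpos : (0 : Matrix m m ℂ) ≤ Aᴴ * A := (posSemidef_conjTranspose_mul_self A).nonneg
  set G := CFC.sqrt (Aᴴ * A) with hG
  have hGG : G * G = Aᴴ * A := CFC.sqrt_mul_sqrt_self _ hpos
  have hGH : Gᴴ = G := (CFC.sqrt_nonneg (Aᴴ * A)).posSemidef.isHermitian
  have hu : IsUnit (G * G) := hGG ▸ (hA.star.mul hA)
  have hdet : IsUnit G.det := by
    rw [isUnit_iff_isUnit_det, det_mul] at hu
    exact isUnit_of_mul_isUnit_left hu
  refine ⟨A * G⁻¹, ?_, G, (isUnit_iff_isUnit_det _).2 hdet, ?_, ?_⟩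
  · rw [mem_unitaryGroup_iff', star_eq_conjTranspose, conjTranspose_mul, conjTranspose_nonsing_inv,
      hGH, Matrix.mul_assoc, ← Matrix.mul_assoc Aᴴ, ← hGG, Matrix.mul_assoc,
      mul_nonsing_inv _ hdet, Matrix.mul_one, nonsing_inv_mul _ hdet]
  · rw [Matrix.mul_assoc, nonsing_inv_mul _ hdet, Matrix.mul_one]
  · intro P hP
    rw [hG, CFC.sqrt_eq_cfc]
    exact (hP.symm.cfc_nnreal _).symm

end Matrices

/-! ### Positivity of the top power of a positive form -/

section TopPower

open Equiv

variable {V : Type*} [AddCommGroup V]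

/-- The multilinear form `v ↦ ∏ i, β (v (i, 0)) (v (i, 1))`. -/
def pairProduct [Module ℝ V] (n : ℕ) (β : V →ₗ[ℝ] V →ₗ[ℝ] ℝ) :
    MultilinearMap ℝ (fun _ : Fin n × Fin 2 => V) ℝ :=
  -- Updating one slot changes only the factor of index `k`. The decidability instance is arbitrary
  -- because the fields of `MultilinearMap` bring their own.
  have key : ∀ [DecidableEq (Fin n × Fin 2)] (v : Fin n × Fin 2 → V) (k : Fin n) (a : Fin 2)
      (x : V), ∏ i, β (Function.update v (k, a) x (i, 0)) (Function.update v (k, a) x (i, 1)) =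
        (if a = 0 then β x (v (k, 1)) else β (v (k, 0)) x) *
          ∏ i ∈ Finset.univ.erase k, β (v (i, 0)) (v (i, 1)) := by
    intro _ v k a x
    rw [← Finset.mul_prod_erase _ _ (Finset.mem_univ k)]
    congr 1
    · fin_cases a <;> simp
    · refine Finset.prod_congr rfl fun i hi => ?_
      have hik : i ≠ k := Finset.ne_of_mem_erase hi
      simp [hik]
  { toFun := fun v => ∏ i, β (v (i, 0)) (v (i, 1))
    map_update_add' := by
      rintro _ v ⟨k, a⟩ x y
      simp only [key]
      split_ifs <;> simp [add_mul]
    map_update_smul' := by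
      rintro _ v ⟨k, a⟩ c x
      simp only [key]
      split_ifs <;> simp [mul_assoc] }

/-- As an alternating map of top degree, the wedge power scales by a determinant under change of
frame. -/
theorem wedgePowDivFactorial_eq_alternatization [Module ℝ V] (n : ℕ) (β : V →ₗ[ℝ] V →ₗ[ℝ] ℝ)
    (v : Fin n × Fin 2 → V) :
    wedgePowDivFactorial n (fun x y => β x y) v =
      (1 / (2 ^ n * (n.factorial : ℝ))) * (pairProduct n β).alternatization v := by
  rw [wedgePowDivFactorial, MultilinearMap.alternatization_apply]
  congr 1
  refine Finset.sum_congr rfl fun σ _ => ?_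
  rw [Units.smul_def, zsmul_eq_mul]
  rfl

/-- A nonzero term forces `σ` to carry pairs to pairs: it permutes the pairs by `τ` and may flip
each one by `ε i`. The pair permutation has sign `(sign τ)² = 1`, and each `sign (ε i)` is cancelled
by the corresponding factor of the product. -/
theorem symplectic_term_nonneg {n : ℕ} (σ : Perm (Fin n × Fin 2)) :
    0 ≤ ((Perm.sign σ : ℤ) : ℝ) * ∏ i : Fin n, (if (σ (i, 0)).1 = (σ (i, 1)).1 then
      (if (σ (i, 0)).2 = (σ (i, 1)).2 then 0 else if (σ (i, 0)).2 = 0 then 1 else -1)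
      else (0 : ℝ)) := by
  by_cases h : ∀ i, (σ (i, 0)).1 = (σ (i, 1)).1
  · have hfst : ∀ i a, (σ (i, a)).1 = (σ (i, 0)).1 := by
      intro i a
      fin_cases a
      · rfl
      · exact (h i).symm
    have hτ : Function.Bijective fun i => (σ (i, 0)).1 := by
      rw [← Finite.surjective_iff_bijective]
      intro j
      obtain ⟨⟨i, a⟩, hia⟩ := σ.surjective (j, 0)
      exact ⟨i, (hfst i a).symm.trans (congrArg Prod.fst hia)⟩
    have hε : ∀ i, Function.Bijective fun a => (σ (i, a)).2 := by
      intro i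
      rw [← Finite.injective_iff_bijective]
      intro a b hab
      have : σ (i, a) = σ (i, b) := Prod.ext (by rw [hfst i a, hfst i b]) hab
      simpa using σ.injective this
    set τ : Perm (Fin n) := Equiv.ofBijective _ hτ with hτd
    set ε : Fin n → Perm (Fin 2) := fun i => Equiv.ofBijective _ (hε i) with hεd
    have hσ : σ = prodCongrLeft (fun _ => τ) * prodCongrRight ε := by
      ext1 ⟨i, a⟩
      exact Prod.ext (hfst i a) rfl
    have hsign : (Perm.sign σ : ℤ) = ∏ i, (Perm.sign (ε i) : ℤ) := by
      rw [hσ, Perm.sign_mul, Perm.sign_prodCongrLeft, Perm.sign_prodCongrRight, Fin.prod_univ_two,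
        Int.units_mul_self, one_mul, Units.coe_prod]
    have hfac : ∀ e : Perm (Fin 2), (if e 0 = e 1 then (0 : ℝ) else if e 0 = 0 then 1 else -1) =
        ((Perm.sign e : ℤ) : ℝ) := by
      intro e
      have : ∀ e : Perm (Fin 2), (if e 0 = e 1 then (0 : ℤ) else if e 0 = 0 then 1 else -1) =
        (Perm.sign e : ℤ) := by decide
      rw [← this e]
      push_cast
      rfl
    rw [hsign, Int.cast_prod, ← Finset.prod_mul_distrib]
    refine Finset.prod_nonneg fun i _ => ?_
    rw [if_pos (h i)]
    have := hfac (ε i)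
    simp only [hεd, Equiv.ofBijective_apply] at this
    rw [this]
    exact mul_self_nonneg _
  · obtain ⟨i, hi⟩ := not_forall.1 h
    rw [Finset.prod_eq_zero (Finset.mem_univ i) (if_neg hi), mul_zero]

variable [Module ℂ V]

/-- The form `β(v, I w) + i β(v, w)` is a Hermitian inner product, conjugate linear in `v`; any
orthonormal basis for it will do. -/
theorem exists_unitary_frame [FiniteDimensional ℂ V] {n : ℕ} (hn : finrank ℂ V = n)
    (β : V →ₗ[ℝ] V →ₗ[ℝ] ℝ) (halt : ∀ v, β v v = 0)
    (hJ : ∀ v w, β (Complex.I • v) (Complex.I • w) = β v w)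
    (hpos : ∀ v, v ≠ 0 → 0 < β v (Complex.I • v)) :
    ∃ u : Basis (Fin n) ℂ V, ∀ i j, β (u i) (u j) = 0 ∧
      β (u i) (Complex.I • u j) = if i = j then 1 else 0 := by
  subst hn
  have hskew : ∀ v w, β w v = -β v w := by
    intro v w
    have := halt (v + w)
    simp only [map_add, LinearMap.add_apply, halt] at this
    linarith
  have hJ1 : ∀ v w, β (Complex.I • v) w = -β v (Complex.I • w) := by
    intro v w
    rw [← hJ (Complex.I • v), smul_smul, Complex.I_mul_I]
    simp
  have hsm : ∀ (c : ℂ) (v : V), c • v = c.re • v + c.im • Complex.I • v := by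
    intro c v
    rw [← Complex.coe_smul, ← Complex.coe_smul, smul_smul, ← add_smul, Complex.re_add_im]
  let core : InnerProductSpace.Core ℂ V :=
    { inner := fun v w => ⟨β v (Complex.I • w), β v w⟩
      conj_inner_symm := fun v w => by
        apply Complex.ext
        · simpa [hJ1] using hskew (Complex.I • v) w
        · simp [hskew v w]
      re_inner_nonneg := fun v => by
        by_cases hv : v = 0
        · simp [hv]
        · exact (hpos v hv).le
      add_left := fun u v w => by
        apply Complex.ext <;> simp
      smul_left := fun v w c => by
        apply Complex.ext
        · rw [hsm c v]
          simp [hJ1, smul_smul]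
        · rw [hsm c v]
          simp [hJ1]
      definite := fun v hv => by
        by_contra hne
        exact (hpos v hne).ne' (congrArg Complex.re hv) }
  let _ : NormedAddCommGroup V := core.toNormedAddCommGroup
  let _ : InnerProductSpace ℂ V := InnerProductSpace.ofCore core.toCore
  let b := stdOrthonormalBasis ℂ V
  have hb : ∀ i j, (⟨β (b i) (Complex.I • b j), β (b i) (b j)⟩ : ℂ) = if i = j then 1 else 0 :=
    fun i j => orthonormal_iff_ite.1 b.orthonormal i j
  refine ⟨b.toBasis, fun i j => ⟨?_, ?_⟩⟩
  · have := congrArg Complex.im (hb i j)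
    rw [b.coe_toBasis]
    split_ifs at this <;> simpa using this
  · have := congrArg Complex.re (hb i j)
    rw [b.coe_toBasis]
    split_ifs at this ⊢ <;> simpa using this

end TopPower

theorem realFrame_eq_smulTower (n : ℕ) :
    realFrame n = Complex.basisOneI.smulTower' (Pi.basisFun ℂ (Fin n)) := by
  ext ⟨i, a⟩ j
  fin_cases a <;> simp [realFrame, Basis.smulTower', Pi.single_apply]

/-- A complex linear map has real determinant `|det|²`, so positivity may be tested on a unitary
frame. There every term of the alternating sum is nonnegative and the identity permutation
contributes `1`. -/
theorem wedgePowDivFactorial_realFrame_pos {n : ℕ} (β : Cx n →ₗ[ℝ] Cx n →ₗ[ℝ] ℝ)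
    (halt : ∀ v, β v v = 0) (hJ : ∀ v w, β (Complex.I • v) (Complex.I • w) = β v w)
    (hpos : ∀ v, v ≠ 0 → 0 < β v (Complex.I • v)) :
    0 < wedgePowDivFactorial n (fun x y => β x y) (realFrame n) := by
  obtain ⟨u, hu⟩ := exists_unitary_frame (Module.finrank_fin_fun ℂ) β halt hJ hpos
  set e : Basis (Fin n × Fin 2) ℝ (Cx n) :=
    Complex.basisOneI.smulTower' (Pi.basisFun ℂ (Fin n)) with he
  set L : Cx n ≃ₗ[ℂ] Cx n := (Pi.basisFun ℂ (Fin n)).equiv u (Equiv.refl _) with hL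
  set W := (pairProduct n β).alternatization with hW
  have hdet : 0 < (L.toLinearMap.restrictScalars ℝ).det := by
    rw [LinearMap.det_restrictScalars, Algebra.norm_complex_apply, Complex.normSq_pos]
    exact (LinearEquiv.isUnit_det' L).ne_zero
  have hcomp : W (L.toLinearMap.restrictScalars ℝ ∘ e) =
      (L.toLinearMap.restrictScalars ℝ).det * W e := by
    rw [W.eq_smul_basis_det e]
    rw [AlternatingMap.smul_apply, AlternatingMap.smul_apply, Basis.det_comp, smul_eq_mul,
      smul_eq_mul]
    ring
  have hLe : ∀ a, (L.toLinearMap.restrictScalars ℝ ∘ e) a =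
      (if a.2 = 0 then u a.1 else Complex.I • u a.1) := by
    rintro ⟨i, a⟩
    have hLi : L (Pi.single i 1) = u i := by
      simpa using (Pi.basisFun ℂ (Fin n)).equiv_apply i u (Equiv.refl _)
    fin_cases a <;> simp [he, Basis.smulTower', hLi]
  have hskew : ∀ v w, β w v = -β v w := by
    intro v w
    have := halt (v + w)
    simp only [map_add, LinearMap.add_apply, halt] at this
    linarith
  have hval : ∀ a b : Fin n × Fin 2, β ((L.toLinearMap.restrictScalars ℝ ∘ e) a)
      ((L.toLinearMap.restrictScalars ℝ ∘ e) b) =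
      if a.1 = b.1 then (if a.2 = b.2 then 0 else if a.2 = 0 then 1 else -1) else 0 := by
    rintro ⟨i, a⟩ ⟨j, b⟩
    rw [hLe, hLe]
    fin_cases a <;> fin_cases b
    · simp [hu]
    · simp [hu]
    · simp [hskew (u j), hu, eq_comm (a := i), apply_ite (Neg.neg : ℝ → ℝ)]
    · simp [hu, hJ]
  have hpos' : 0 < W (L.toLinearMap.restrictScalars ℝ ∘ e) := by
    rw [hW, MultilinearMap.alternatization_apply]
    refine Finset.sum_pos' (fun σ _ => ?_) ⟨1, Finset.mem_univ _, ?_⟩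
    · refine (symplectic_term_nonneg σ).trans_eq ?_
      rw [Units.smul_def, zsmul_eq_mul]
      congr 1
      exact Finset.prod_congr rfl fun i _ => (hval _ _).symm
    · rw [Equiv.Perm.sign_one, one_smul]
      change 0 < ∏ i : Fin n, β _ _
      refine Finset.prod_pos fun i _ => ?_
      refine lt_of_lt_of_eq one_pos (Eq.trans ?_ (hval (i, 0) (i, 1)).symm)
      simp
  rw [hcomp] at hpos'
  rw [wedgePowDivFactorial_eq_alternatization, realFrame_eq_smulTower]
  have := pos_of_mul_pos_right hpos' hdet.le
  positivity

/-! ### The integral against the volume form of a Kähler form -/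

section Integral

open MeasureTheory

variable {n : ℕ} {M : Type*} [TopologicalSpace M] [ChartedSpace (Cx n) M]

theorem KaehlerForm.density_continuousOn (κ : KaehlerForm n M) (p : M) :
    ContinuousOn (κ.density p) (chartAt (Cx n) p).target := by
  unfold KaehlerForm.density wedgePowDivFactorial
  exact continuousOn_const.mul <| continuousOn_finsetSum _ fun σ _ => continuousOn_const.mul <|
    continuousOn_finsetProd _ fun i _ => (κ.smooth p _ _).continuousOn

/-- The derivative of the inverse chart is injective and complex linear, so the pulled back form is
still positive and invariant. -/
theorem KaehlerForm.density_pos [IsManifold 𝓘(ℂ, Cx n) ω M] (κ : KaehlerForm n M) (p : M)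
    {y : Cx n} (hy : y ∈ (chartAt (Cx n) p).target) : 0 < κ.density p y := by
  set D := mfderiv 𝓘(ℂ, Cx n) 𝓘(ℂ, Cx n) (chartAt (Cx n) p).symm y with hD
  have hmd : (chartAt (Cx n) p).MDifferentiable 𝓘(ℂ, Cx n) 𝓘(ℂ, Cx n) :=
    have : IsManifold 𝓘(ℂ, Cx n) 1 M := IsManifold.of_le (n := ω) le_top
    mdifferentiable_chart p
  have hinj : Function.Injective D := hmd.symm.mfderiv_injective hy
  let D' : Cx n →ₗ[ℝ] TangentSpace 𝓘(ℂ, Cx n) ((chartAt (Cx n) p).symm y) :=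
    D.toLinearMap.restrictScalars ℝ
  refine wedgePowDivFactorial_realFrame_pos
    ((κ.form ((chartAt (Cx n) p).symm y)).compl₁₂ D' D') (fun v => κ.alternating _ _)
    (fun v w => ?_) (fun v hv => ?_)
  · change κ.form _ (D (Complex.I • v)) (D (Complex.I • w)) = κ.form _ (D v) (D w)
    exact (congrArg₂ (fun a b => κ.form _ a b) (D.map_smul _ v) (D.map_smul _ w)).trans
      (κ.complex_invariant _ _ _)
  · change 0 < κ.form _ (D v) (D (Complex.I • v))
    refine lt_of_lt_of_eq (κ.positive _ (D v) fun h => hv (hinj (h.trans (map_zero D).symm))) ?_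
    exact congrArg (fun b => κ.form _ (D v) b) (D.map_smul _ v).symm

variable [CompactSpace M] [T2Space M]

theorem chartPartition_support_finite :
    {p : M | (Function.support (chartPartition n M p)).Nonempty}.Finite :=
  (chartPartition n M).locallyFinite.finite_nonempty_of_compact

/-- The integrand of `KaehlerForm.integral` in the chart at `p`. -/
def KaehlerForm.chartIntegrand (κ : KaehlerForm n M) (f : M → ℂ) (p : M) (y : Cx n) : ℂ :=
  ((chartPartition n M p ((chartAt (Cx n) p).symm y) * κ.density p y : ℝ) : ℂ)
      * f ((chartAt (Cx n) p).symm y)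

theorem KaehlerForm.integral_eq_sum (κ : KaehlerForm n M) (f : M → ℂ) :
    κ.integral f = ∑ p ∈ (chartPartition_support_finite (n := n) (M := M)).toFinset,
      ∫ y in (chartAt (Cx n) p).target, κ.chartIntegrand f p y := by
  refine finsum_eq_sum_of_support_subset _ fun p hp => ?_
  rw [Set.Finite.coe_toFinset]
  by_contra h
  refine hp ?_
  have h0 : ∀ x, chartPartition n M p x = 0 := fun x => by
    by_contra hx
    exact h ⟨x, hx⟩
  simp [h0]

theorem KaehlerForm.chartIntegrand_continuousOn (κ : KaehlerForm n M) {f : M → ℂ}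
    (hf : Continuous f) (p : M) :
    ContinuousOn (κ.chartIntegrand f p) (chartAt (Cx n) p).target := by
  have hs := (chartAt (Cx n) p).continuousOn_symm
  refine ContinuousOn.mul (Complex.continuous_ofReal.comp_continuousOn
    (ContinuousOn.mul ?_ (κ.density_continuousOn p))) (hf.comp_continuousOn hs)
  exact (chartPartition n M p).continuous.comp_continuousOn hs

/-- The density may be unbounded on the chart's target, but the partition function cuts the
integrand down to a compact subset `K`. -/
theorem KaehlerForm.chartIntegrand_integrableOn (κ : KaehlerForm n M) {f : M → ℂ}
    (hf : Continuous f) (p : M) :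
    IntegrableOn (κ.chartIntegrand f p) (chartAt (Cx n) p).target := by
  set c := chartAt (Cx n) p
  set K := c '' tsupport (chartPartition n M p) with hK
  have hsub : tsupport (chartPartition n M p) ⊆ c.source :=
    (exists_chartPartition n M).choose_spec p
  have hKc : IsCompact K :=
    (isClosed_tsupport _).isCompact.image_of_continuousOn (c.continuousOn.mono hsub)
  have hKt : K ⊆ c.target := by
    rintro _ ⟨x, hx, rfl⟩
    exact c.map_source (hsub hx)
  refine IntegrableOn.of_forall_sdiff_eq_zero (s := K)
    (((κ.chartIntegrand_continuousOn hf p).mono hKt).integrableOn_compact hKc)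
    c.open_target.measurableSet fun y hy => ?_
  have : chartPartition n M p (c.symm y) = 0 := by
    by_contra h
    exact hy.2 ⟨c.symm y, subset_tsupport _ h, c.right_inv hy.1⟩
  simp [chartIntegrand, c, this]

theorem KaehlerForm.integral_sum (κ : KaehlerForm n M) {ι : Type*} (t : Finset ι) (c : ι → ℂ)
    {f : ι → M → ℂ} (hf : ∀ i, Continuous (f i)) :
    κ.integral (fun x => ∑ i ∈ t, c i * f i x) = ∑ i ∈ t, c i * κ.integral (f i) := by
  simp only [κ.integral_eq_sum, Finset.mul_sum]
  rw [Finset.sum_comm]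
  refine Finset.sum_congr rfl fun p _ => ?_
  have : ∀ y, κ.chartIntegrand (fun x => ∑ i ∈ t, c i * f i x) p y =
      ∑ i ∈ t, c i * κ.chartIntegrand (f i) p y := fun y => by
    simp only [chartIntegrand, Finset.mul_sum]
    exact Finset.sum_congr rfl fun i _ => by ring
  simp only [this]
  rw [MeasureTheory.integral_finsetSum]
  · exact Finset.sum_congr rfl fun i _ => MeasureTheory.integral_const_mul _ _
  · exact fun i _ => (κ.chartIntegrand_integrableOn (hf i) p).const_mul _

/-- A nonnegative continuous function whose integral vanishes is zero. -/
theorem KaehlerForm.eq_zero_of_integral_eq_zero [IsManifold 𝓘(ℂ, Cx n) ω M] (κ : KaehlerForm n M)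
    {f : M → ℝ} (hf : Continuous f) (h0 : ∀ x, 0 ≤ f x) (hint : κ.integral (fun x => (f x : ℂ)) = 0)
    (x : M) : f x = 0 := by
  have hfc : Continuous fun x => (f x : ℂ) := Complex.continuous_ofReal.comp hf
  let g : M → Cx n → ℝ := fun p y =>
    chartPartition n M p ((chartAt (Cx n) p).symm y) * κ.density p y * f ((chartAt (Cx n) p).symm y)
  have hg : ∀ p, κ.chartIntegrand (fun x => (f x : ℂ)) p = fun y => (g p y : ℂ) := fun p => by
    ext y
    simp [chartIntegrand, g]
  have hg0 : ∀ p, ∀ y ∈ (chartAt (Cx n) p).target, 0 ≤ g p y := fun p y hy =>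
    mul_nonneg (mul_nonneg ((chartPartition n M).nonneg _ _) (κ.density_pos p hy).le) (h0 _)
  have hgi : ∀ p, IntegrableOn (g p) (chartAt (Cx n) p).target := fun p => by
    have := (κ.chartIntegrand_integrableOn hfc p).re
    simp only [hg] at this
    exact this
  have hgc : ∀ p, ContinuousOn (g p) (chartAt (Cx n) p).target := fun p => by
    have := Complex.continuous_re.comp_continuousOn (κ.chartIntegrand_continuousOn hfc p)
    simpa [hg, Function.comp_def] using this
  rw [κ.integral_eq_sum] at hint
  simp only [hg, integral_complex_ofReal] at hint
  rw [← Complex.ofReal_sum, Complex.ofReal_eq_zero, Finset.sum_eq_zero_iff_of_nonneg] at hint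
  -- Each chart contributes a nonnegative amount, so all contributions vanish. In a chart with
  -- positive weight at `x` the integrand is continuous and almost everywhere zero on an open set,
  -- hence zero at `x`.
  · obtain ⟨p, hp⟩ := (chartPartition n M).exists_pos (Set.mem_univ x)
    have hx : x ∈ (chartAt (Cx n) p).source :=
      (exists_chartPartition n M).choose_spec p (subset_tsupport _ hp.ne')
    have hz := hint p ((Set.Finite.mem_toFinset _).2 ⟨x, hp.ne'⟩)
    rw [setIntegral_eq_zero_iff_of_nonneg_ae _ (hgi p)] at hz
    · have := Measure.eqOn_open_of_ae_eq hz (chartAt (Cx n) p).open_target (hgc p)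
        continuousOn_const ((chartAt (Cx n) p).map_source hx)
      have hd := κ.density_pos p ((chartAt (Cx n) p).map_source hx)
      simpa [g, (chartAt (Cx n) p).left_inv hx, hp.ne', hd.ne'] using this
    · exact (ae_restrict_iff' (chartAt (Cx n) p).open_target.measurableSet).2 (ae_of_all _ (hg0 p))
  · exact fun p _ => setIntegral_nonneg (chartAt (Cx n) p).open_target.measurableSet (hg0 p)

theorem KaehlerForm.vol_ne_zero [IsManifold 𝓘(ℂ, Cx n) ω M] [Nonempty M] (κ : KaehlerForm n M) :
    κ.vol ≠ 0 := by
  intro h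
  have := κ.eq_zero_of_integral_eq_zero (f := fun _ => 1) continuous_const (fun _ => zero_le_one)
    (by simpa [KaehlerForm.vol] using h) (Classical.arbitrary M)
  exact one_ne_zero this

end Integral

/-! ### Smoothness of matrix-valued functions -/

section SmoothMatrices

open Matrix

variable {F H X : Type*} [NormedAddCommGroup F] [NormedSpace ℂ F] [TopologicalSpace H]
  {I : ModelWithCorners ℂ F H} [TopologicalSpace X] [ChartedSpace H X] {x : X}
  {ι κ μ : Type*} [Fintype κ]

theorem contMDiffAt_matrix_mul {A : X → Matrix ι κ ℂ} {B : X → Matrix κ μ ℂ}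
    (hA : ∀ i j, ContMDiffAt I 𝓘(ℂ, ℂ) ω (fun y => A y i j) x)
    (hB : ∀ i j, ContMDiffAt I 𝓘(ℂ, ℂ) ω (fun y => B y i j) x) (i : ι) (j : μ) :
    ContMDiffAt I 𝓘(ℂ, ℂ) ω (fun y => (A y * B y) i j) x := by
  simp only [Matrix.mul_apply]
  exact ContMDiffAt.sum fun l _ => (hA i l).mul (hB l j)

theorem contMDiffAt_matrix_det [Fintype ι] [DecidableEq ι] {A : X → Matrix ι ι ℂ}
    (hA : ∀ i j, ContMDiffAt I 𝓘(ℂ, ℂ) ω (fun y => A y i j) x) :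
    ContMDiffAt I 𝓘(ℂ, ℂ) ω (fun y => (A y).det) x := by
  simp only [Matrix.det_apply']
  exact ContMDiffAt.sum fun σ _ => contMDiffAt_const.mul (contMDiffAt_finsetProd fun i _ => hA _ _)

theorem contMDiffAt_matrix_inv [Fintype ι] [DecidableEq ι] {A : X → Matrix ι ι ℂ}
    (hA : ∀ i j, ContMDiffAt I 𝓘(ℂ, ℂ) ω (fun y => A y i j) x) (h : (A x).det ≠ 0) (i j : ι) :
    ContMDiffAt I 𝓘(ℂ, ℂ) ω (fun y => (A y)⁻¹ i j) x := by
  simp only [Matrix.inv_def, Ring.inverse_eq_inv', Matrix.smul_apply, smul_eq_mul,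
    Matrix.adjugate_apply]
  refine ContMDiffAt.mul ?_ (contMDiffAt_matrix_det fun k l => ?_)
  · exact (contDiffAt_inv ℂ h).contMDiffAt.comp x (contMDiffAt_matrix_det hA)
  -- An adjugate entry is the determinant of the matrix with row `j` replaced by a constant row.
  · by_cases hk : k = j
    · subst hk
      simpa using contMDiffAt_const
    · simpa [Matrix.updateRow_ne hk] using hA k l

end SmoothMatrices

/-! ### Continuity of matrix products and column projections -/

theorem continuousAt_matrix_mul {X : Type*} [TopologicalSpace X] {x : X} {l m k : Type*} [Fintype m]
    {A : X → Matrix l m ℂ} {B : X → Matrix m k ℂ} (hA : ContinuousAt A x) (hB : ContinuousAt B x) :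
    ContinuousAt (fun y => A y * B y) x := by
  have h : Continuous fun z : Matrix l m ℂ × Matrix m k ℂ => z.1 * z.2 :=
    Continuous.matrix_mul continuous_fst continuous_snd
  exact ContinuousAt.comp (f := fun y => (A y, B y)) h.continuousAt (hA.prodMk hB)

theorem continuousAt_columnProj {X : Type*} [TopologicalSpace X] {x : X} {m k : Type*} [Fintype m]
    [Fintype k] [DecidableEq k] {S : X → Matrix m k ℂ} (hS : ContinuousAt S x)
    (h : IsUnit ((S x).conjTranspose * S x).det) : ContinuousAt (fun y => columnProj (S y)) x := by
  have hc : ContinuousAt (fun y => (S y).conjTranspose) x :=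
    ContinuousAt.comp (f := S) (continuous_id.matrix_conjTranspose).continuousAt hS
  have hinv : ContinuousAt (fun y => ((S y).conjTranspose * S y)⁻¹) x := by
    refine ContinuousAt.comp (g := Inv.inv) (continuousAt_matrix_inv _ ?_)
      (continuousAt_matrix_mul hc hS)
    rw [Ring.inverse_eq_inv']
    exact continuousAt_inv₀ h.ne_zero
  exact continuousAt_matrix_mul (continuousAt_matrix_mul hS hinv) hc

section HolomorphicBundle

open Matrix
open scoped ComplexOrder

variable {n r : ℕ} {M : Type*} [TopologicalSpace M] [ChartedSpace (Cx n) M]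
  {E : M → Type*} [∀ x, AddCommGroup (E x)] [∀ x, Module ℂ (E x)]
  [∀ x, TopologicalSpace (E x)] [TopologicalSpace (TotalSpace (Cx r) E)]
  [FiberBundle (Cx r) E] [VectorBundle ℂ (Cx r) E] {N : ℕ}

/-! ### Coefficients of sections in the local trivializations -/

/-- The matrix of the coefficients of sections in the trivialization of `E` at `p`. -/
def frameMatrix (s : Fin N → H0 n r E) (p x : M) : Matrix (Fin N) (Fin r) ℂ :=
  Matrix.of fun j α => (trivializationAt (Cx r) E p ⟨x, s j x⟩).2 α

theorem contMDiffAt_frameMatrix [ContMDiffVectorBundle ω (Cx r) E 𝓘(ℂ, Cx n)]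
    (s : Fin N → H0 n r E) (p : M) (j : Fin N) (α : Fin r) :
    ContMDiffAt 𝓘(ℂ, Cx n) 𝓘(ℂ, ℂ) ω (fun x => frameMatrix s p x j α) p :=
  contMDiffAt_pi_space.1 ((contMDiffAt_section p).1 (s j).contMDiff.contMDiffAt) α

variable {p x : M} (hx : x ∈ (trivializationAt (Cx r) E p).baseSet)

/-- The functional on the fibre whose coefficients in the trivialization of `E` at `p` are `c`. -/
def frameDual (c : Cx r) : Dual ℂ (E x) :=
  (Fintype.linearCombination ℂ c).comp
    ((trivializationAt (Cx r) E p).linearEquivAt ℂ x hx).toLinearMap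

theorem frameDual_surjective : Function.Surjective (frameDual hx) := by
  intro l
  set φ := (trivializationAt (Cx r) E p).linearEquivAt ℂ x hx with hφ
  refine ⟨fun α => l (φ.symm (Pi.single α 1)), ?_⟩
  ext v
  obtain ⟨w, rfl⟩ := φ.symm.surjective v
  have : w = ∑ α, w α • Pi.single α (1 : ℂ) := by
    ext; simp [Finset.sum_apply, Pi.single_apply]
  conv_rhs => rw [this]
  simp [frameDual, Fintype.linearCombination_apply, ← hφ]

theorem frameDual_injective : Function.Injective (frameDual (E := E) hx) := by
  intro c d h
  ext α
  set φ := (trivializationAt (Cx r) E p).linearEquivAt ℂ x hx with hφ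
  have := LinearMap.congr_fun h (φ.symm (Pi.single α 1))
  simpa [frameDual, Fintype.linearCombination_apply, Pi.single_apply, ← hφ] using this

theorem evalDual_frameDual (s : Basis (Fin N) ℂ (H0 n r E)) (c : Cx r) :
    evalDual s x (frameDual hx c) = WithLp.toLp 2 (frameMatrix s p x *ᵥ c) := by
  ext j
  simp [evalDual, frameDual, Fintype.linearCombination_apply, frameMatrix, mulVec, dotProduct]

/-- Global generation makes the columns of `S` independent, and `Sᴴ S d = 0` forces `S d = 0`. -/
theorem isUnit_det_gram_frameMatrix (hx : x ∈ (trivializationAt (Cx r) E p).baseSet)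
    (hE : GloballyGenerated n r E)
    (s : Basis (Fin N) ℂ (H0 n r E)) :
    IsUnit ((frameMatrix s p x)ᴴ * frameMatrix s p x).det := by
  rw [← isUnit_iff_isUnit_det, ← mulVec_injective_iff_isUnit]
  have hinj : ∀ d : Cx r, frameMatrix s p x *ᵥ d = 0 → d = 0 := fun d hd =>
    frameDual_injective hx <| evalDual_injective hE s x <| by
      rw [evalDual_frameDual, evalDual_frameDual, hd, mulVec_zero]
  intro c d hcd
  refine sub_eq_zero.1 (hinj _ ?_)
  rw [← conjTranspose_mul_self_mulVec_eq_zero, mulVec_sub, sub_eq_zero]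
  exact hcd

/-! ### The induced metric -/

/-- `l` represents the vector `v` if `k v` is the product of the points of `ℂᴺ` defined by
`l` and `k`, for every functional `k`. -/
def Represents (s : Basis (Fin N) ℂ (H0 n r E)) {x : M} (l : Dual ℂ (E x)) (v : E x) : Prop :=
  ∀ k : Dual ℂ (E x), inner ℂ (evalDual s x l) (evalDual s x k) = k v

theorem toQuot_apply (hE : GloballyGenerated n r E) (s : Basis (Fin N) ℂ (H0 n r E)) (x : M)
    (v : E x) (l : Dual ℂ (E x)) : toQuot hE s x v (dualEquivTaut hE s x l) = l v := by
  simp [toQuot]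

theorem Represents.toDual_symm {hE : GloballyGenerated n r E} {s : Basis (Fin N) ℂ (H0 n r E)}
    {l : Dual ℂ (E x)} {v : E x} (h : Represents s l v) :
    (InnerProductSpace.toDual ℂ (kodairaMap hE s x).Taut).symm (toQuot hE s x v) =
      dualEquivTaut hE s x l := by
  rw [LinearIsometryEquiv.symm_apply_eq]
  ext t
  obtain ⟨k, rfl⟩ := (dualEquivTaut hE s x).surjective t
  rw [toQuot_apply, ← h k]
  rfl

theorem exists_represents (hE : GloballyGenerated n r E) (s : Basis (Fin N) ℂ (H0 n r E))
    (v : E x) : ∃ l, Represents s l v := by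
  obtain ⟨l, hl⟩ := (dualEquivTaut hE s x).surjective
    ((InnerProductSpace.toDual ℂ (kodairaMap hE s x).Taut).symm (toQuot hE s x v))
  refine ⟨l, fun k => ?_⟩
  rw [LinearIsometryEquiv.eq_symm_apply] at hl
  rw [← toQuot_apply hE s x v k, ← hl]
  rfl

theorem inducedMetric_eq_inner (hE : GloballyGenerated n r E) {s : Basis (Fin N) ℂ (H0 n r E)}
    {l m : Dual ℂ (E x)} {v w : E x} (hl : Represents s l v) (hm : Represents s m w) :
    inducedMetric hE s x v w = inner ℂ (evalDual s x l) (evalDual s x m) := by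
  rw [inducedMetric, Gr.metric, hl.toDual_symm, hm.toDual_symm]
  rfl

/-- The induced metric is dual to the product that `evalDual` pulls back to `E_x⋆`. A map whose
transpose preserves these products carries Riesz representatives to Riesz representatives. -/
theorem inducedMetric_map (hE : GloballyGenerated n r E) {N' : ℕ} (s : Basis (Fin N) ℂ (H0 n r E))
    (s' : Basis (Fin N') ℂ (H0 n r E)) (f : E x ≃ₗ[ℂ] E x)
    (h : ∀ k l : Dual ℂ (E x), inner ℂ (evalDual s' x k) (evalDual s' x l) =
      inner ℂ (evalDual s x (k.comp f.toLinearMap)) (evalDual s x (l.comp f.toLinearMap)))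
    (v w : E x) : inducedMetric hE s' x (f v) (f w) = inducedMetric hE s x v w := by
  have key : ∀ (l : Dual ℂ (E x)) (v : E x), Represents s l v →
      Represents s' (l.comp f.symm.toLinearMap) (f v) := by
    intro l v hl k
    rw [h, LinearMap.comp_assoc]
    simpa using hl (k.comp f.toLinearMap)
  obtain ⟨l, hl⟩ := exists_represents hE s v
  obtain ⟨m, hm⟩ := exists_represents hE s w
  rw [inducedMetric_eq_inner hE hl hm, inducedMetric_eq_inner hE (key l v hl) (key m w hm), h]
  simp [LinearMap.comp_assoc]

/-- On the column space, `s_j(x)` is the `j`-th coordinate functional, whose Riesz representative is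
the projection `P e_j`; and `⟨P e_j, P e_k⟩ = P_jk`. -/
theorem inducedMetric_basis (hx : x ∈ (trivializationAt (Cx r) E p).baseSet)
    (hE : GloballyGenerated n r E) (s : Basis (Fin N) ℂ (H0 n r E))
    (j k : Fin N) :
    inducedMetric hE s x (s j x) (s k x) = columnProj (frameMatrix s p x) j k := by
  set S := frameMatrix s p x with hS
  -- The coefficients of `P e_i` in the columns of `S`.
  set c : Fin N → Cx r := fun i => ((Sᴴ * S)⁻¹ * Sᴴ) *ᵥ Pi.single i 1 with hc
  have hev : ∀ i, evalDual s x (frameDual hx (c i)) =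
      WithLp.toLp 2 (columnProj S *ᵥ Pi.single i 1) := by
    intro i
    rw [evalDual_frameDual, hc, mulVec_mulVec, columnProj, Matrix.mul_assoc]
  have hrep : ∀ i, Represents s (frameDual hx (c i)) (s i x) := by
    intro i l
    obtain ⟨d, rfl⟩ := frameDual_surjective hx l
    have h1 : frameDual hx d (s i x) = (S *ᵥ d) i :=
      congrArg (fun z : EuclideanSpace ℂ (Fin N) => z i) (evalDual_frameDual hx s d)
    have h2 : columnProj S *ᵥ (S *ᵥ d) = S *ᵥ d := by
      rw [mulVec_mulVec, columnProj_mul (isUnit_det_gram_frameMatrix hx hE s)]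
    rw [h1, hev, evalDual_frameDual, EuclideanSpace.inner_toLp_toLp, ← hS, ← congrFun h2 i]
    conv_rhs => rw [← columnProj_isHermitian S]
    simp [mulVec, dotProduct, mul_comm, Matrix.col]
  rw [inducedMetric_eq_inner hE (hrep j) (hrep k), hrep j]
  have := congrArg (fun z : EuclideanSpace ℂ (Fin N) => z j) (hev k)
  simpa [evalDual] using this

end HolomorphicBundle

section HolomorphicBundle

open Matrix

variable {n r : ℕ} {M : Type*} [TopologicalSpace M] [ChartedSpace (Cx n) M]
  {E : M → Type*} [∀ x, AddCommGroup (E x)] [∀ x, Module ℂ (E x)]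
  [∀ x, TopologicalSpace (E x)] [TopologicalSpace (TotalSpace (Cx r) E)]
  [FiberBundle (Cx r) E] [VectorBundle ℂ (Cx r) E] {N : ℕ}

theorem inducedMetric_basis_continuous [ContMDiffVectorBundle ω (Cx r) E 𝓘(ℂ, Cx n)]
    (hE : GloballyGenerated n r E) (s : Basis (Fin N) ℂ (H0 n r E)) (j k : Fin N) :
    Continuous fun x => inducedMetric hE s x (s j x) (s k x) := by
  refine continuous_iff_continuousAt.2 fun p => ?_
  have hp := mem_baseSet_trivializationAt (Cx r) E p
  have hS : ContinuousAt (frameMatrix s p) p := continuousAt_pi.2 fun i => continuousAt_pi.2 fun α =>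
    (contMDiffAt_frameMatrix s p i α).continuousAt
  have hc := continuousAt_columnProj hS (isUnit_det_gram_frameMatrix hp hE s)
  have hjk : ContinuousAt (fun x => columnProj (frameMatrix s p x) j k) p :=
    continuousAt_pi.1 (continuousAt_pi.1 hc j) k
  refine hjk.congr ?_
  filter_upwards [(trivializationAt (Cx r) E p).open_baseSet.mem_nhds hp] with x hx
  exact (inducedMetric_basis hx hE s j k).symm

/-! ### Bundle maps induced by matrices -/

theorem fibre_linearMap_ext (hE : GloballyGenerated n r E) (s : Basis (Fin N) ℂ (H0 n r E)) {x : M}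
    {V : Type*} [AddCommGroup V] [Module ℂ V] {f g : E x →ₗ[ℂ] V}
    (h : ∀ k, f (s k x) = g (s k x)) : f = g := by
  ext v
  obtain ⟨t, rfl⟩ := hE x v
  let ev : H0 n r E →ₗ[ℂ] E x :=
    { toFun := fun u => u x
      map_add' := fun u w => by simp
      map_smul' := fun c u => by simp }
  have : f.comp ev = g.comp ev := s.ext h
  exact LinearMap.congr_fun this t

/-- The linear map acts on the values of the sections `s k` by the matrix `G`. -/
def ActsBy (s : Fin N → H0 n r E) (G : Matrix (Fin N) (Fin N) ℂ) {x : M} (f : E x →ₗ[ℂ] E x) :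
    Prop :=
  ∀ k, f (s k x) = ∑ l, G k l • s l x

/-- Commuting with the projection, `G` preserves the column space, so `G S = S R` with `R = (Sᴴ S)⁻¹
Sᴴ G S`. The rows of `S` are the coordinates of the `s_k(x)`, so `w ↦ w R` is the desired map. -/
theorem exists_actsBy (hE : GloballyGenerated n r E) (s : Basis (Fin N) ℂ (H0 n r E))
    (G : Matrix (Fin N) (Fin N) ℂ) (x : M) (hG : Commute (columnProj (frameMatrix s x x)) G) :
    ∃ f : E x →ₗ[ℂ] E x, ActsBy s G f := by
  have hx := mem_baseSet_trivializationAt (Cx r) E x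
  set S := frameMatrix s x x with hS
  set φ := (trivializationAt (Cx r) E x).linearEquivAt ℂ x hx with hφ
  have hrow : ∀ k, φ (s k x) = S k := fun k => rfl
  have hSR : S * ((Sᴴ * S)⁻¹ * Sᴴ * G * S) = G * S := by
    rw [← Matrix.mul_assoc, ← Matrix.mul_assoc, ← Matrix.mul_assoc]
    change columnProj S * G * S = G * S
    rw [hG.eq, Matrix.mul_assoc, columnProj_mul (isUnit_det_gram_frameMatrix hx hE s)]
  refine ⟨φ.symm.toLinearMap ∘ₗ (Matrix.vecMulLinear ((Sᴴ * S)⁻¹ * Sᴴ * G * S)) ∘ₗ φ.toLinearMap,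
    fun k => φ.injective ?_⟩
  have h1 : φ (∑ l, G k l • s l x) = (G * S) k := by
    ext α
    simp [hrow, Matrix.mul_apply]
  rw [h1, ← hSR]
  simp only [LinearMap.comp_apply, LinearEquiv.coe_coe, LinearEquiv.apply_symm_apply, hrow]
  rfl

/-- The order is reversed: `f' ∘ f` acts by `G * G'`. -/
theorem ActsBy.comp (hE : GloballyGenerated n r E) {s : Basis (Fin N) ℂ (H0 n r E)}
    {G G' : Matrix (Fin N) (Fin N) ℂ} {x : M} {f f' : E x →ₗ[ℂ] E x} (hf : ActsBy s G f)
    (hf' : ActsBy s G' f') (h : G * G' = 1) : f' ∘ₗ f = LinearMap.id :=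
  fibre_linearMap_ext hE s fun k => by
    rw [LinearMap.comp_apply, hf k, map_sum]
    simp only [map_smul, hf' _, Finset.smul_sum, smul_smul]
    rw [Finset.sum_comm]
    simp only [← Finset.sum_smul, ← Matrix.mul_apply, h]
    simp [Matrix.one_apply]

theorem contMDiff_of_actsBy [ContMDiffVectorBundle ω (Cx r) E 𝓘(ℂ, Cx n)]
    (hE : GloballyGenerated n r E) (s : Basis (Fin N) ℂ (H0 n r E)) (G : Matrix (Fin N) (Fin N) ℂ)
    {f : (x : M) → E x →ₗ[ℂ] E x} (hf : ∀ x, ActsBy s G (f x)) :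
    ContMDiff (𝓘(ℂ, Cx n).prod 𝓘(ℂ, Cx r)) (𝓘(ℂ, Cx n).prod 𝓘(ℂ, Cx r)) ω
      (fun z : TotalSpace (Cx r) E => (⟨z.1, f z.1 z.2⟩ : TotalSpace (Cx r) E)) := by
  intro z
  rw [contMDiffAt_totalSpace]
  refine ⟨contMDiffAt_proj E, ?_⟩
  obtain ⟨p, v⟩ := z
  set e := trivializationAt (Cx r) E p with he
  have hp : p ∈ e.baseSet := mem_baseSet_trivializationAt (Cx r) E p
  -- The formula with `S(x)ᴴ` is not holomorphic in `x`. Freezing this factor at `p` gives `R = (C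
  -- S)⁻¹ C G S`, which is holomorphic and valid wherever `C S` is still invertible.
  set C := (frameMatrix s p p)ᴴ with hC
  have hdet : (C * frameMatrix s p p).det ≠ 0 := (isUnit_det_gram_frameMatrix hp hE s).ne_zero
  have hS := contMDiffAt_frameMatrix s p
  have hCS : ∀ i j, ContMDiffAt 𝓘(ℂ, Cx n) 𝓘(ℂ, ℂ) ω (fun x => (C * frameMatrix s p x) i j) p :=
    contMDiffAt_matrix_mul (fun _ _ => contMDiffAt_const) hS
  have hR : ∀ i j, ContMDiffAt 𝓘(ℂ, Cx n) 𝓘(ℂ, ℂ) ω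
      (fun x => ((C * frameMatrix s p x)⁻¹ * (C * (G * frameMatrix s p x))) i j) p :=
    contMDiffAt_matrix_mul (contMDiffAt_matrix_inv hCS hdet)
      (contMDiffAt_matrix_mul (fun _ _ => contMDiffAt_const)
        (contMDiffAt_matrix_mul (fun _ _ => contMDiffAt_const) hS))
  have hproj : ContMDiffAt (𝓘(ℂ, Cx n).prod 𝓘(ℂ, Cx r)) 𝓘(ℂ, Cx n) ω
      (fun z : TotalSpace (Cx r) E => z.1) ⟨p, v⟩ := contMDiffAt_proj E
  have hsnd : ContMDiffAt (𝓘(ℂ, Cx n).prod 𝓘(ℂ, Cx r)) 𝓘(ℂ, Cx r) ω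
      (fun z : TotalSpace (Cx r) E => (e z).2) ⟨p, v⟩ :=
    (contMDiffAt_totalSpace.1 (contMDiffAt_id (x := (⟨p, v⟩ : TotalSpace (Cx r) E)))).2
  have hmain : ContMDiffAt (𝓘(ℂ, Cx n).prod 𝓘(ℂ, Cx r)) 𝓘(ℂ, Cx r) ω
      (fun z : TotalSpace (Cx r) E => (e z).2 ᵥ*
        ((C * frameMatrix s p z.1)⁻¹ * (C * (G * frameMatrix s p z.1)))) ⟨p, v⟩ := by
    refine contMDiffAt_pi_space.2 fun α => ?_
    simp only [vecMul, dotProduct]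
    exact ContMDiffAt.sum fun β _ => (contMDiffAt_pi_space.1 hsnd β).mul
      (ContMDiffAt.comp (g := fun x =>
        ((C * frameMatrix s p x)⁻¹ * (C * (G * frameMatrix s p x))) β α)
        (⟨p, v⟩ : TotalSpace (Cx r) E) (hR β α) hproj)
  refine hmain.congr_of_eventuallyEq ?_
  have hev : ∀ᶠ x in nhds p, x ∈ e.baseSet ∧ (C * frameMatrix s p x).det ≠ 0 :=
    Filter.Eventually.and (e.open_baseSet.mem_nhds hp)
      ((contMDiffAt_matrix_det hCS).continuousAt.eventually_ne hdet)
  filter_upwards [hproj.continuousAt.eventually hev] with ⟨x, w⟩ ⟨hx, hd⟩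
  set S := frameMatrix s p x with hSx
  set φ := e.linearEquivAt ℂ x hx with hφ
  set R : Matrix (Fin r) (Fin r) ℂ :=
    (LinearMap.toMatrix' (φ.toLinearMap ∘ₗ f x ∘ₗ φ.symm.toLinearMap))ᵀ with hRdef
  have happ : ∀ w : E x, φ (f x w) = φ w ᵥ* R := by
    intro w
    rw [hRdef, vecMul_transpose, LinearMap.toMatrix'_mulVec]
    simp
  have hrow : ∀ k, φ (s k x) = S k := fun k => rfl
  have hSR : S * R = G * S := by
    ext k α
    have := congrFun (happ (s k x)) α
    rw [hf x k, hrow] at this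
    rw [Matrix.mul_apply_eq_vecMul, ← this]
    simp [hrow, Matrix.mul_apply]
  have hReq : (C * S)⁻¹ * (C * (G * S)) = R := by
    rw [← hSR, ← Matrix.mul_assoc C, ← Matrix.mul_assoc, nonsing_inv_mul _ (isUnit_iff_ne_zero.2 hd),
      Matrix.one_mul]
  change φ (f x w) = φ w ᵥ* ((C * S)⁻¹ * (C * (G * S)))
  rw [hReq, happ]

theorem exists_bundleAut_of_commute [ContMDiffVectorBundle ω (Cx r) E 𝓘(ℂ, Cx n)]
    (hE : GloballyGenerated n r E) (s : Basis (Fin N) ℂ (H0 n r E))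
    {G : Matrix (Fin N) (Fin N) ℂ} (hu : IsUnit G)
    (hG : ∀ x, Commute (columnProj (frameMatrix s x x)) G) :
    ∃ F : BundleAut n r E, ∀ x, ActsBy s G (F.toEquiv x).toLinearMap := by
  obtain ⟨u, rfl⟩ := hu
  choose f hf using fun x => exists_actsBy hE s _ x (hG x)
  choose g hg using fun x => exists_actsBy hE s _ x ((hG x).units_inv_right)
  exact ⟨{ toEquiv := fun x => LinearEquiv.ofLinearMap (f x) (g x) ((hg x).comp hE (hf x) u.inv_mul)
              ((hf x).comp hE (hg x) u.mul_inv)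
           holomorphic := contMDiff_of_actsBy hE s _ hf
           holomorphic_symm := contMDiff_of_actsBy hE s _ hg }, hf⟩

/-! ### The action of automorphisms on sections -/

/-- The action of an automorphism of `E` on `H⁰(M, E)`. -/
def BundleAut.onSections (F : BundleAut n r E) : H0 n r E ≃ₗ[ℂ] H0 n r E where
  toFun t := ⟨fun x => F.toEquiv x (t x), F.holomorphic.comp t.contMDiff⟩
  invFun t := ⟨fun x => (F.toEquiv x).symm (t x), F.holomorphic_symm.comp t.contMDiff⟩
  map_add' t u := by ext x; exact map_add (F.toEquiv x) _ _
  map_smul' c t := by ext x; exact map_smul (F.toEquiv x) _ _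
  left_inv t := by ext x; exact (F.toEquiv x).symm_apply_apply _
  right_inv t := by ext x; exact (F.toEquiv x).apply_symm_apply _

theorem BundleAut.onSections_apply (F : BundleAut n r E) (t : H0 n r E) (x : M) :
    F.onSections t x = F.toEquiv x (t x) := rfl

theorem inducedMetric_onSections (hE : GloballyGenerated n r E) (F : BundleAut n r E)
    (s : Basis (Fin N) ℂ (H0 n r E)) (x : M) (v w : E x) :
    inducedMetric hE (s.map F.onSections) x (F.toEquiv x v) (F.toEquiv x w) =
      inducedMetric hE s x v w := by
  have h : ∀ l : Dual ℂ (E x), evalDual (s.map F.onSections) x l =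
      evalDual s x (l.comp (F.toEquiv x).toLinearMap) := fun l => by
    ext j
    simp [evalDual, BundleAut.onSections_apply]
  exact inducedMetric_map hE _ _ _ (fun k l => by rw [h, h]) v w

end HolomorphicBundle

theorem inner_toEuclideanLin_of_mem_unitaryGroup {N : ℕ} {U : Matrix (Fin N) (Fin N) ℂ}
    (hU : U ∈ Matrix.unitaryGroup (Fin N) ℂ) (a b : EuclideanSpace ℂ (Fin N)) :
    inner ℂ (Matrix.toEuclideanLin U a) (Matrix.toEuclideanLin U b) = inner ℂ a b := by
  rw [← LinearMap.adjoint_inner_right, ← Matrix.toEuclideanLin_conjTranspose_eq_adjoint]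
  congr 1
  rw [Matrix.mem_unitaryGroup_iff', Matrix.star_eq_conjTranspose] at hU
  ext j
  simp [Matrix.mulVec_mulVec, hU]

section Balanced

open Matrix

variable {n r : ℕ} {M : Type*} [TopologicalSpace M] [ChartedSpace (Cx n) M]
  {E : M → Type*} [∀ x, AddCommGroup (E x)] [∀ x, Module ℂ (E x)]
  [∀ x, TopologicalSpace (E x)] [TopologicalSpace (TotalSpace (Cx r) E)]
  [FiberBundle (Cx r) E] [VectorBundle ℂ (Cx r) E] {N : ℕ}

/-! ### Comparison of two balanced bases -/

/-- The matrix of the coefficients of one basis of `H⁰(M, E)` in another. -/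
def changeMatrix (s s' : Basis (Fin N) ℂ (H0 n r E)) : Matrix (Fin N) (Fin N) ℂ :=
  (s.toMatrix s')ᵀ

theorem isUnit_changeMatrix (s s' : Basis (Fin N) ℂ (H0 n r E)) : IsUnit (changeMatrix s s') :=
  (Matrix.isUnit_transpose _).2 (IsUnit.of_mul_eq_one _ (s.toMatrix_mul_toMatrix_flip s'))

theorem basis_apply_eq_sum (s s' : Basis (Fin N) ℂ (H0 n r E)) (j : Fin N) (x : M) :
    s' j x = ∑ k, changeMatrix s s' j k • s k x := by
  let ev : H0 n r E →ₗ[ℂ] E x :=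
    { toFun := fun u => u x
      map_add' := fun u w => by simp
      map_smul' := fun c u => by simp }
  have := congrArg ev (s.sum_repr (s' j))
  rw [map_sum] at this
  exact this.symm

theorem frameMatrix_eq_changeMatrix_mul (s s' : Basis (Fin N) ℂ (H0 n r E)) (x : M) :
    frameMatrix s' x x = changeMatrix s s' * frameMatrix s x x := by
  ext j α
  set φ := (trivializationAt (Cx r) E x).linearEquivAt ℂ x (mem_baseSet_trivializationAt (Cx r) E x)
  have hrow : ∀ (s : Basis (Fin N) ℂ (H0 n r E)) k, φ (s k x) = frameMatrix s x x k :=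
    fun _ _ => rfl
  rw [← hrow, basis_apply_eq_sum s s' j x]
  simp [hrow, Matrix.mul_apply]

theorem trace_columnProj_mul_eq_sum (hE : GloballyGenerated n r E)
    (s : Basis (Fin N) ℂ (H0 n r E)) (B : Matrix (Fin N) (Fin N) ℂ) (x : M) :
    (columnProj (frameMatrix s x x) * B).trace =
      ∑ i : Fin N × Fin N, B i.2 i.1 * inducedMetric hE s x (s i.1 x) (s i.2 x) := by
  rw [Fintype.sum_prod_type]
  simp only [trace, diag_apply, Matrix.mul_apply,
    inducedMetric_basis (mem_baseSet_trivializationAt (Cx r) E x) hE s, mul_comm]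

/-- The trivialization used at `x` may jump with `x`, but the entries of the projection are the
values `h_s(s_j, s_k)`, which do not depend on it. -/
theorem continuous_trace_columnProj_mul [ContMDiffVectorBundle ω (Cx r) E 𝓘(ℂ, Cx n)]
    (hE : GloballyGenerated n r E)
    (s : Basis (Fin N) ℂ (H0 n r E)) (B : Matrix (Fin N) (Fin N) ℂ) :
    Continuous fun x => (columnProj (frameMatrix s x x) * B).trace := by
  simp only [trace_columnProj_mul_eq_sum hE s B]
  exact continuous_finsetSum _ fun i _ =>
    continuous_const.mul (inducedMetric_basis_continuous hE s i.1 i.2)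

variable [CompactSpace M] [T2Space M]

theorem KaehlerForm.integral_sub (κ : KaehlerForm n M) {f g : M → ℂ} (hf : Continuous f)
    (hg : Continuous g) : κ.integral (fun x => f x - g x) = κ.integral f - κ.integral g := by
  have := κ.integral_sum (Finset.univ : Finset (Fin 2)) ![1, -1] (f := ![f, g])
    (fun i => by fin_cases i <;> assumption)
  simpa [Fin.sum_univ_two, sub_eq_add_neg] using this

variable {κ : KaehlerForm n M} {hE : GloballyGenerated n r E}

theorem IsBalancedBasis.onSections {s : Basis (Fin N) ℂ (H0 n r E)} (hs : IsBalancedBasis κ hE s)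
    (F : BundleAut n r E) : IsBalancedBasis κ hE (s.map F.onSections) := by
  intro j k
  rw [← hs j k]
  simp only [l2Product, Basis.map_apply, BundleAut.onSections_apply, inducedMetric_onSections]

variable [IsManifold 𝓘(ℂ, Cx n) ω M] [ContMDiffVectorBundle ω (Cx r) E 𝓘(ℂ, Cx n)]

/-- Balance says that the projection integrates to `V(M) (r / N)` times the identity. Recovering
integrals from `l2Product` needs a nonzero volume, hence a nonempty `M`. -/
theorem IsBalancedBasis.integral_trace [Nonempty M] {s : Basis (Fin N) ℂ (H0 n r E)}
    (hs : IsBalancedBasis κ hE s) (B : Matrix (Fin N) (Fin N) ℂ) :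
    κ.integral (fun x => (columnProj (frameMatrix s x x) * B).trace) =
      κ.vol * ((r : ℂ) / N) * B.trace := by
  simp only [trace_columnProj_mul_eq_sum hE s B]
  rw [κ.integral_sum _ (fun i : Fin N × Fin N => B i.2 i.1)
    (fun i => inducedMetric_basis_continuous hE s i.1 i.2), Fintype.sum_prod_type]
  have h : ∀ j k, κ.integral (fun x => inducedMetric hE s x (s j x) (s k x)) =
      κ.vol * (if j = k then (r : ℂ) / N else 0) := fun j k => by
    rw [← hs j k, l2Product, mul_inv_cancel_left₀ κ.vol_ne_zero]
  simp only [h, mul_ite, mul_zero, Finset.sum_ite_eq, Finset.mem_univ, if_true, trace, diag_apply,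
    Finset.mul_sum]
  exact Finset.sum_congr rfl fun i _ => by ring

/-- The matrix relating two balanced bases intertwines the projections onto the points of the
Grassmannian defined by the two bases. -/
theorem IsBalancedBasis.columnProj_intertwine {s s' : Basis (Fin N) ℂ (H0 n r E)}
    (hs : IsBalancedBasis κ hE s) (hs' : IsBalancedBasis κ hE s') (x : M) :
    columnProj (frameMatrix s' x x) * changeMatrix s s' =
      changeMatrix s s' * columnProj (frameMatrix s x x) := by
  have : Nonempty M := ⟨x⟩
  set A := changeMatrix s s' with hA
  set X : M → Matrix (Fin N) (Fin N) ℂ := fun y =>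
    columnProj (frameMatrix s' y y) * A - A * columnProj (frameMatrix s y y) with hX
  have hD : ∀ y, ((∑ i, ∑ j, ‖X y i j‖ ^ 2 : ℝ) : ℂ) =
      (columnProj (frameMatrix s' y y) * (A * Aᴴ)).trace -
        (columnProj (frameMatrix s y y) * (Aᴴ * A)).trace := fun y => by
    have hy := mem_baseSet_trivializationAt (Cx r) E y
    have h1 := isUnit_det_gram_frameMatrix hy hE s
    have h2 := isUnit_det_gram_frameMatrix hy hE s'
    rw [← trace_mul_conjTranspose_eq_sum]
    simp only [hX]
    rw [frameMatrix_eq_changeMatrix_mul s s'] at h2 ⊢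
    exact (trace_columnProj_sub h1 h2).symm
  have hc := (continuous_trace_columnProj_mul hE s' (A * Aᴴ)).sub
    (continuous_trace_columnProj_mul hE s (Aᴴ * A))
  have hDc : Continuous fun y => ∑ i, ∑ j, ‖X y i j‖ ^ 2 := by
    refine (Complex.continuous_re.comp hc).congr fun y => ?_
    exact (congrArg Complex.re (hD y)).symm.trans (Complex.ofReal_re _)
  -- By balance of both bases the two integrals are the same multiple of `tr(A A⋆)` and of `tr(A⋆
  -- A)`.
  have hint : κ.integral (fun y => ((∑ i, ∑ j, ‖X y i j‖ ^ 2 : ℝ) : ℂ)) = 0 := by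
    simp only [hD]
    rw [κ.integral_sub (continuous_trace_columnProj_mul hE s' _)
      (continuous_trace_columnProj_mul hE s _), hs'.integral_trace, hs.integral_trace,
      trace_mul_comm, sub_self]
  have h0 := κ.eq_zero_of_integral_eq_zero hDc
    (fun y => Finset.sum_nonneg fun i _ => Finset.sum_nonneg fun j _ => sq_nonneg _) hint x
  rw [← sub_eq_zero]
  ext i j
  have h1 := (Finset.sum_eq_zero_iff_of_nonneg fun i _ =>
    Finset.sum_nonneg fun j _ => sq_nonneg _).1 h0 i (Finset.mem_univ i)
  have h2 := (Finset.sum_eq_zero_iff_of_nonneg fun j _ => sq_nonneg _).1 h1 j (Finset.mem_univ j)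
  exact norm_eq_zero.1 (pow_eq_zero_iff two_ne_zero |>.1 h2)

/-- In the polar form `A = U G` the factor `G` descends to `F`. Then `evalDual s'` is `U` after
`evalDual s` after the transpose of `F`, which yields both the Kodaira maps and, `U` being unitary,
the metrics. -/
theorem IsBalancedBasis.exists_unitary_bundleAut {s s' : Basis (Fin N) ℂ (H0 n r E)}
    (hs : IsBalancedBasis κ hE s) (hs' : IsBalancedBasis κ hE s') :
    ∃ U ∈ Matrix.unitaryGroup (Fin N) ℂ, ∃ F : BundleAut n r E,
      (∀ (j : Fin N) (x : M), s' j x = ∑ k, U j k • F.toEquiv x (s k x)) ∧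
      (∀ x : M, (kodairaMap hE s' x).1 = (kodairaMap hE s x).1.map (Matrix.toEuclideanLin U)) ∧
      (∀ (x : M) (v w : E x), inducedMetric hE s' x (F.toEquiv x v) (F.toEquiv x w) =
        inducedMetric hE s x v w) := by
  obtain ⟨U, hU, G, hG, hA, hcomm⟩ := exists_polar (isUnit_changeMatrix s s')
  obtain ⟨F, hF⟩ := exists_bundleAut_of_commute hE s hG fun x => hcomm _ <| commute_columnProj <| by
    rw [← frameMatrix_eq_changeMatrix_mul, hs.columnProj_intertwine hs']
  have hsU : ∀ (j : Fin N) (x : M), s' j x = ∑ k, U j k • F.toEquiv x (s k x) := by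
    intro j x
    have h : ∀ k, F.toEquiv x (s k x) = ∑ l, G k l • s l x := hF x
    simp only [h, Finset.smul_sum, smul_smul]
    rw [Finset.sum_comm, basis_apply_eq_sum s s' j x, hA]
    simp only [← Finset.sum_smul, ← Matrix.mul_apply]
  have hev : ∀ x (l : Dual ℂ (E x)), evalDual s' x l =
      Matrix.toEuclideanLin U (evalDual s x (l.comp (F.toEquiv x).toLinearMap)) := by
    intro x l
    ext j
    simp [evalDual, hsU j x, Matrix.mulVec, dotProduct]
  refine ⟨U, hU, F, hsU, fun x => ?_, fun x v w => ?_⟩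
  · ext t
    simp only [kodairaMap, Submodule.mem_map, LinearMap.mem_range, exists_exists_eq_and, hev]
    constructor
    · rintro ⟨l, hl⟩
      exact ⟨_, hl⟩
    · rintro ⟨l, hl⟩
      refine ⟨l.comp (F.toEquiv x).symm.toLinearMap, ?_⟩
      rw [← hl, LinearMap.comp_assoc]
      simp
  · refine inducedMetric_map hE s s' _ (fun k l => ?_) v w
    rw [hev, hev, inner_toEuclideanLin_of_mem_unitaryGroup hU]

end Balanced

end

/-! ### Uniqueness of balanced metrics -/

theorem mainTheorem1 {n r : ℕ} {M : Type*} [TopologicalSpace M] [ChartedSpace (Cx n) M]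
    [IsManifold 𝓘(ℂ, Cx n) ω M] [CompactSpace M] [T2Space M]
    (E : M → Type*) [∀ x, AddCommGroup (E x)] [∀ x, Module ℂ (E x)]
    [∀ x, TopologicalSpace (E x)] [TopologicalSpace (TotalSpace (Cx r) E)]
    [FiberBundle (Cx r) E] [VectorBundle ℂ (Cx r) E]
    [ContMDiffVectorBundle ω (Cx r) E 𝓘(ℂ, Cx n)]
    (κ : KaehlerForm n M) (hE : GloballyGenerated n r E) :
    (∀ h h' : HermitianMetric n r E, IsBalancedMetric κ hE h →
      (IsBalancedMetric κ hE h' ↔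
        ∃ F : BundleAut n r E, ∀ (x : M) (v w : E x),
          h'.toFun x (F.toEquiv x v) (F.toEquiv x w) = h.toFun x v w)) ∧
    (∀ (N : ℕ) (s s' : Basis (Fin N) ℂ (H0 n r E)),
      IsBalancedBasis κ hE s → IsBalancedBasis κ hE s' →
        ∃ U ∈ Matrix.unitaryGroup (Fin N) ℂ, ∃ F : BundleAut n r E,
          (∀ (j : Fin N) (x : M), s' j x = ∑ k, U j k • F.toEquiv x (s k x)) ∧
          (∀ x : M, (kodairaMap hE s' x).1 =
            (kodairaMap hE s x).1.map (Matrix.toEuclideanLin U)) ∧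
          (∀ (x : M) (v w : E x), inducedMetric hE s' x (F.toEquiv x v) (F.toEquiv x w) =
            inducedMetric hE s x v w)) := by
  have part2 : ∀ (N : ℕ) (s s' : Basis (Fin N) ℂ (H0 n r E)),
      IsBalancedBasis κ hE s → IsBalancedBasis κ hE s' → _ :=
    fun N s s' hs hs' => hs.exists_unitary_bundleAut hs'
  refine ⟨fun h h' ⟨N, s, hhs, hs⟩ => ⟨?_, ?_⟩, part2⟩
  · rintro ⟨N', s', hhs', hs'⟩
    -- The two metrics come with their own `N`; both equal `dim H⁰(M, E)`.
    obtain rfl : N = N' := by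
      have h1 := Module.finrank_eq_card_basis s
      have h2 := Module.finrank_eq_card_basis s'
      simpa [h1] using h2
    obtain ⟨U, -, F, -, -, hF⟩ := part2 N s s' hs hs'
    exact ⟨F, fun x v w => by rw [hhs', hhs, hF]⟩
  · rintro ⟨F, hF⟩
    -- The basis `F s_1, …, F s_N` is again balanced and induces `h'`.
    refine ⟨N, s.map F.onSections, fun x v w => ?_, hs.onSections F⟩
    obtain ⟨v, rfl⟩ := (F.toEquiv x).surjective v
    obtain ⟨w, rfl⟩ := (F.toEquiv x).surjective w
    rw [hF, inducedMetric_onSections, hhs]
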